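/- **Setting.** Logarithms are to base $2$, and $0\log 0=0$. Let $V$ be a set of $n$ vertices with an ordered partition $\mathcal P=(V_1,\dots,V_r)$. Two labeled graphs $G,G'$ on $V$ are *partition-isomorphic* if there is a graph isomorphism $\phi\colon G\to G'$ with $\phi(V_i)=V_i$ for all $i$; the equivalence classes are called *partitioned structures*, and we write $G\cong_{\mathcal P}S$ if $G$ lies in the class $S$. In the stochastic block model $\mathcal G(n,p,q)$ on $(V,\mathcal P)$, pairs of distinct vertices are edges independently, with probability $p$ if both ends lie in the same block and with probability $q$ otherwise. It induces the distribution $P(S)=\sum_{G\cong_{\mathcal P}S}P(G)$ on partitioned structures, whose entropy $H^r_{\mathcal S}=-\sum_S P(S)\log P(S)$ is the *partitioned structural entropy*. Let $h(p)=-p\log p-(1-p)\log(1-p)$. **Theorem.** Fix reals $x_1,\dots,x_r\in(0,1)$ with $\sum_i x_i=1$, and sequences $p=p(n)$, $q=q(n)$ in $[0,1]$ such that, as $n\to\infty$, $\frac{\ln n}{n}=o(p)$, $\frac{\ln n}{n}=o(q)$ and $\frac{\ln n}{n}=o(1-p)$. For each $n$ consider partitions of an $n$-element set $V$ into $V_1,\dots,V_r$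 with $|V_i|=x_in$, rounded up or down if $x_in$ is not an integer (that is, $\bigl||V_i|-x_in\bigr|<1$). Put $z=\sum_{i=1}^r\binom{|V_i|}{2}$. Then: (i) There is $\alpha>0$ such that, as $n\to\infty$ and uniformly over these partitions, $$H^r_{\mathcal S}=z\,(h(p)-h(q))+\binom n2h(q)-\sum_{i=1}^r\log\bigl(|V_i|!\bigr)+O\!\left(\frac{\log n}{n^{\alpha}}\right).$$ In particular, if $|V_i|=n/r$ for all $i$, the sum is $r\log\left(\frac nr\right)!$. (ii) For every $\varepsilon>0$ there is $N$ such that for all $n\ge N$ and all these partitions, the random partitioned structure $S$ satisfies $$P\left(\left|-\frac{1}{\binom n2}\log P(S)-\frac{z}{\binom n2}(h(p)-h(q))-h(q)+\frac{\Lambda}{\binom n2}\right|<3\varepsilon\right)>1-4\varepsilon,$$ both for $\Lambda=\sum_{i=1}^r\log\bigl(|V_i|!\bigr)$ and for $\Lambda=r\log\left(\frac nr\right)!$, where $\left(\frac nr\right)!$ means $\Gamma\left(\frac nr+1\right)$. -/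

import Mathlib

open Finset Filter Asymptotics

noncomputable section

namespace SBM

variable {V : Type} [Fintype V] {r : ℕ}

/-- The block `V_i` of the ordered partition of `V` given by the assignment `c : V → Fin r`. -/
def block (c : V → Fin r) (i : Fin r) : Finset V :=
  {v | c v = i}

/-- All unordered pairs of distinct vertices. -/
def pairs (V : Type) [Fintype V] : Finset (Sym2 V) :=
  open Classical in {e | ¬ e.IsDiag}

/-- The probability that the pair `e` is an edge: `p` if both ends lie in the same block, and
`q` otherwise. -/
def edgeProb (c : V → Fin r) (p q : ℝ) (e : Sym2 V) : ℝ :=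
  if (e.map c).IsDiag then p else q

/-- The probability `P(G)` of the labeled graph `G` in the stochastic block model: the pairs of
distinct vertices are edges independently of each other, `e` with probability `edgeProb c p q e`. -/
def graphProb (c : V → Fin r) (p q : ℝ) (G : SimpleGraph V) : ℝ :=
  open Classical in
  ∏ e ∈ pairs V, if e ∈ G.edgeSet then edgeProb c p q e else 1 - edgeProb c p q e

/-- Partition-respecting isomorphism of labeled graphs: an isomorphism that maps every block
to itself. -/
def partitionIso (c : V → Fin r) : Setoid (SimpleGraph V) where
  r G G' := ∃ φ : G ≃g G', ∀ i, φ '' (block c i : Set V) = block c i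
  iseqv :=
    { refl := fun G => ⟨RelIso.refl _, fun i => by simp⟩
      symm := by
        rintro G G' ⟨φ, h⟩
        refine ⟨φ.symm, fun i => ?_⟩
        nth_rewrite 1 [← h i]
        rw [Set.image_image]
        simp
      trans := by
        rintro G₁ G₂ G₃ ⟨φ, h⟩ ⟨ψ, k⟩
        refine ⟨φ.trans ψ, fun i => ?_⟩
        have : (φ.trans ψ) '' (block c i : Set V) = ψ '' (φ '' (block c i : Set V)) := by
          rw [Set.image_image]; rfl
        rw [this, h i, k i] }

/-- The partitioned unlabeled graphs (partitioned structures) on `V`. -/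
def Structure (c : V → Fin r) : Type := Quotient (partitionIso c)

/-- The partitioned structure of a labeled graph. -/
def structureOf (c : V → Fin r) (G : SimpleGraph V) : Structure c :=
  Quotient.mk (partitionIso c) G

instance (c : V → Fin r) : Finite (Structure c) :=
  inferInstanceAs (Finite (Quotient (partitionIso c)))

instance (c : V → Fin r) : Fintype (Structure c) := Fintype.ofFinite _

/-- The probability `P(S)` of the partitioned structure `S`, the sum of `P(G)` over all labeled
graphs `G` with structure `S`. -/
def structProb (c : V → Fin r) (p q : ℝ) (S : Structure c) : ℝ :=
  open Classical in ∑ G : SimpleGraph V with structureOf c G = S, graphProb c p q G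

/-- The probability of the event `A` for a random partitioned structure. -/
def prob (c : V → Fin r) (p q : ℝ) (A : Set (Structure c)) : ℝ :=
  open Classical in ∑ S : Structure c with S ∈ A, structProb c p q S

/-- The entropy, in bits, of a distribution `P` on the partitioned structures. -/
def structuralEntropy (c : V → Fin r) (P : Structure c → ℝ) : ℝ :=
  -∑ S : Structure c, P S * Real.logb 2 (P S)

/-- The binary entropy function, in bits. -/
def h (p : ℝ) : ℝ := -p * Real.logb 2 p - (1 - p) * Real.logb 2 (1 - p)

/-- The number of pairs of distinct vertices inside the blocks. -/
def z (c : V → Fin r) : ℝ := ∑ i, ((#(block c i)).choose 2 : ℝ)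

/-- `∑ log |V_i|!` -/
def logFactorials (c : V → Fin r) : ℝ := ∑ i, Real.logb 2 ((#(block c i)).factorial : ℝ)

open Classical in
/-- The probabilities of the labeled graphs add up to one. -/
theorem sum_graphProb (c : V → Fin r) (p q : ℝ) :
    ∑ G : SimpleGraph V, graphProb c p q G = 1 := by
  have h1 := Finset.prod_add (fun e => edgeProb c p q e) (fun e => 1 - edgeProb c p q e) (pairs V)
  simp only [add_sub_cancel, Finset.prod_const_one] at h1
  rw [h1]
  refine Finset.sum_bij' (fun G _ => (pairs V).filter (· ∈ G.edgeSet))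
    (fun t _ => SimpleGraph.fromEdgeSet (t : Set (Sym2 V))) ?_ ?_ ?_ ?_ ?_
  · intro G _
    simp
  · intro t _
    simp
  · intro G _
    ext a b
    simp only [SimpleGraph.fromEdgeSet_adj, Finset.coe_filter, pairs, Set.mem_ofPred_eq,
      Finset.mem_filter, Finset.mem_univ, true_and, SimpleGraph.mem_edgeSet, Sym2.mk_isDiag_iff]
    exact ⟨fun hh => hh.1.2, fun hh => ⟨⟨hh.ne, hh⟩, hh.ne⟩⟩
  · intro t ht
    rw [Finset.mem_powerset] at ht
    ext e
    simp only [Finset.mem_filter, SimpleGraph.edgeSet_fromEdgeSet, Set.mem_sdiff, Finset.mem_coe]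
    constructor
    · exact fun hh => hh.2.1
    · intro he
      have := ht he
      simp only [pairs, Finset.mem_filter, Finset.mem_univ, true_and] at this
      exact ⟨ht he, he, this⟩
  · intro G _
    unfold graphProb
    rw [Finset.prod_ite]
    congr 1
    apply Finset.prod_congr _ (fun _ _ => rfl)
    ext e
    simp only [Finset.mem_filter, Finset.mem_sdiff]
    tauto

end SBM

end

noncomputable section

namespace SBM

/-! ### Product weights on functions `ι → Bool` -/

section ProductWeights

variable {ι : Type*} [Fintype ι] [DecidableEq ι]

/-! Let a(G) be the number of block-preserving automorphisms of G. By orbit–stabilizer the structure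
of G consists of ∏|V_i|!/a(G) labeled graphs, all equally likely, so log P(S) = log P(G) + ∑
log|V_i|! - log a(G) whenever P(G) ≠ 0 (`logb_structProb`). The mean of log P(G) is an exact sum
over independent pairs, so the error in (i) is exactly E log a(G) (`structuralEntropy_structProb`,
`sum_graphProb_mul_logProb`).

Since log a ≤ (a - 1)/ln 2, it suffices to bound E a(G), the sum over σ of the probability that σ
fixes G. A fixed graph is constant on the cycles of σ on pairs; a cycle of length l ≥ 2 inside the
blocks costs p^l + (1-p)^l ≤ exp(-p(1-p)l). If σ moves k vertices and all blocks have at least m, it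
moves at least (m-2)k/2 pairs inside blocks, so the probability is at most t^k with t =
exp(-p(1-p)(m-2)/2). Summing over σ gives at most (1+nt)^n ≤ exp(n²t). The growth of p and 1-p makes
t ≤ n⁻³, whence E log a(G) = O(1/n).

For (ii), Chebyshev controls log P(G), whose variance is O(n²) uniformly in p and q, and Markov
controls log a(G) (`one_sub_le_prob`). Both choices of Λ lie between 0 and r log n! = o(n²), so they
are interchangeable. -/

theorem sum_prod_mul_prod (w g : ι → Bool → ℝ) :
    ∑ ω : ι → Bool, (∏ e, w e (ω e)) * ∏ e, g e (ω e) = ∏ e, ∑ b, w e b * g e b := by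
  simp_rw [← Finset.prod_mul_distrib]
  rw [Finset.prod_univ_sum, Fintype.piFinset_univ]

theorem sum_prod_mul_apply (w : ι → Bool → ℝ) (hw : ∀ e, ∑ b, w e b = 1) (e : ι) (f : Bool → ℝ) :
    ∑ ω : ι → Bool, (∏ e, w e (ω e)) * f (ω e) = ∑ b, w e b * f b := by
  have := sum_prod_mul_prod w (fun e' b => if e' = e then f b else 1)
  simp only [Finset.prod_ite_eq', Finset.mem_univ, if_true] at this
  rw [this, Finset.prod_eq_single e]
  · simp
  · intro e' _ he
    simp only [he, if_false, mul_one]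
    exact hw e'
  · simp

theorem sum_prod_mul_apply_mul_apply (w : ι → Bool → ℝ) (hw : ∀ e, ∑ b, w e b = 1) {e e' : ι}
    (he : e ≠ e') (f g : Bool → ℝ) :
    ∑ ω : ι → Bool, (∏ e, w e (ω e)) * (f (ω e) * g (ω e')) =
      (∑ b, w e b * f b) * ∑ b, w e' b * g b := by
  have := sum_prod_mul_prod w
    (fun i b => (if i = e then f b else 1) * if i = e' then g b else 1)
  simp only [Finset.prod_mul_distrib, Finset.prod_ite_eq', Finset.mem_univ, if_true] at this
  rw [this, Finset.prod_eq_mul e e' he]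
  · simp [he, he.symm]
  · intro i _ hi
    simp only [hi.1, hi.2, if_false, mul_one]
    exact hw i
  · simp
  · simp

/-- The mean of a sum of functions of the coordinates. -/
theorem sum_prod_mul_sum (w : ι → Bool → ℝ) (hw : ∀ e, ∑ b, w e b = 1) (f : ι → Bool → ℝ) :
    ∑ ω : ι → Bool, (∏ e, w e (ω e)) * ∑ e, f e (ω e) = ∑ e, ∑ b, w e b * f e b := by
  simp_rw [Finset.mul_sum]
  rw [Finset.sum_comm]
  exact Finset.sum_congr rfl fun e _ => (sum_prod_mul_apply w hw e (f e)).trans rfl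

/-- The variance of a sum of functions of the coordinates is at most the sum of the second
moments. -/
theorem variance_sum_le (w : ι → Bool → ℝ) (hw : ∀ e, ∑ b, w e b = 1) (f : ι → Bool → ℝ) :
    ∑ ω : ι → Bool, (∏ e, w e (ω e)) * (∑ e, f e (ω e) - ∑ e, ∑ b, w e b * f e b) ^ 2 ≤
      ∑ e, ∑ b, w e b * f e b ^ 2 := by
  set m : ι → ℝ := fun e => ∑ b, w e b * f e b with hm
  have h0 : ∀ e, ∑ b, w e b * (f e b - m e) = 0 := by
    intro e
    simp_rw [mul_sub]
    rw [Finset.sum_sub_distrib, ← Finset.sum_mul, hw e, one_mul, sub_self]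
  have h1 : ∀ ω : ι → Bool, (∏ e, w e (ω e)) * (∑ e, f e (ω e) - ∑ e, m e) ^ 2 =
      ∑ e, ∑ e', (∏ e, w e (ω e)) * ((f e (ω e) - m e) * (f e' (ω e') - m e')) := by
    intro ω
    rw [← Finset.sum_sub_distrib, sq, Finset.sum_mul_sum]
    simp_rw [Finset.mul_sum]
  simp_rw [h1]
  rw [Finset.sum_comm]
  refine Finset.sum_le_sum fun e _ => ?_
  -- Only the diagonal survives: distinct coordinates are independent and centered.
  rw [Finset.sum_comm, Finset.sum_eq_single e]
  · have := sum_prod_mul_apply w hw e (fun b => (f e b - m e) * (f e b - m e))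
    rw [this]
    have h2 : ∑ b, w e b * ((f e b - m e) * (f e b - m e)) =
        ∑ b, w e b * f e b ^ 2 - m e ^ 2 := by
      have h3 := h0 e
      have h5 := hw e
      simp only [Fintype.sum_bool] at h3 h5 ⊢
      linear_combination -(2 * m e) * h3 + (-(m e ^ 2)) * h5
    rw [h2]
    linarith [sq_nonneg (m e)]
  · intro e' _ he
    have := sum_prod_mul_apply_mul_apply w hw he.symm (fun b => f e b - m e)
      (fun b => f e' b - m e')
    rw [this, h0 e, zero_mul]
  · simp

/-- For k = 2 the left side is 1 - 2ab. Each further factor is harmless because a and b are both at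
most 1 - ab ≤ exp(-ab). At k = 1 the bound can fail, which is why fixed points are treated
separately below. -/
theorem pow_add_pow_le_exp {a b : ℝ} (ha : 0 ≤ a) (hb : 0 ≤ b) (hab : a + b = 1) {k : ℕ}
    (hk : 2 ≤ k) : a ^ k + b ^ k ≤ Real.exp (-(a * b)) ^ k := by
  induction k, hk using Nat.le_induction with
  | base =>
    rw [← Real.exp_nat_mul]
    have h := Real.add_one_le_exp (((2 : ℕ) : ℝ) * -(a * b))
    refine le_trans (le_of_eq ?_) h
    push_cast
    linear_combination (a + b + 1) * hab
  | succ k _ ih =>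
    have h1 : a ≤ Real.exp (-(a * b)) := by
      have := Real.add_one_le_exp (-(a * b))
      nlinarith
    have h2 : b ≤ Real.exp (-(a * b)) := by
      have := Real.add_one_le_exp (-(a * b))
      nlinarith
    calc a ^ (k + 1) + b ^ (k + 1) = a ^ k * a + b ^ k * b := by ring
      _ ≤ a ^ k * Real.exp (-(a * b)) + b ^ k * Real.exp (-(a * b)) := by gcongr
      _ = (a ^ k + b ^ k) * Real.exp (-(a * b)) := by ring
      _ ≤ Real.exp (-(a * b)) ^ k * Real.exp (-(a * b)) := by gcongr
      _ = Real.exp (-(a * b)) ^ (k + 1) := by ring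

open Classical in
/-- The weight of the functions that are invariant under a permutation of the coordinates. -/
theorem sum_invariant_le (τ : Equiv.Perm ι) (w : ι → Bool → ℝ) (hw : ∀ e, ∑ b, w e b = 1)
    (hw0 : ∀ e b, 0 ≤ w e b) (hτ : ∀ e, w (τ e) = w e) :
    ∑ ω : ι → Bool with ω ∘ τ = ω, ∏ e, w e (ω e) ≤
      ∏ e, if τ e = e then 1 else Real.exp (-(w e true * w e false)) := by
  -- Invariant functions are exactly the functions on the cycles of τ, so the sum factors over the
  -- cycles.
  let s : Setoid ι := Equiv.Perm.SameCycle.setoid τ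
  have hconst : ∀ {β : Type} (f : ι → β), (∀ e, f (τ e) = f e) →
      ∀ e e', τ.SameCycle e e' → f e = f e' := by
    rintro β f hf e e' ⟨k, rfl⟩
    have h1 : ∀ k : ℤ, ∀ e, f ((τ ^ k) e) = f e := by
      intro k
      induction k with
      | zero => simp
      | succ k ih => intro e; rw [zpow_add_one, Equiv.Perm.mul_apply, ih, hf]
      | pred k ih =>
        intro e
        rw [zpow_sub_one, Equiv.Perm.mul_apply, ih]
        simpa using (hf (τ⁻¹ e)).symm
    exact (h1 k e).symm
  have h1 : ∑ ω : ι → Bool with ω ∘ τ = ω, ∏ e, w e (ω e) =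
      ∑ ω : Quotient s → Bool, ∏ e, w e (ω (Quotient.mk s e)) := by
    symm
    refine Finset.sum_bij (fun ω _ => ω ∘ Quotient.mk s) ?_ ?_ ?_ ?_
    · intro ω _
      simp only [Finset.mem_filter, Finset.mem_univ, true_and]
      funext e
      simp only [Function.comp]
      congr 1
      exact Quotient.sound (Equiv.Perm.sameCycle_apply_left.2 (Equiv.Perm.SameCycle.refl τ e))
    · intro ω _ ω' _ heq
      exact (Quotient.mk_surjective.injective_comp_right) heq
    · intro ω hω
      simp only [Finset.mem_filter, Finset.mem_univ, true_and] at hω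
      exact ⟨Quotient.lift ω (fun e e' h => hconst ω (fun e => congrFun hω e) e e' h),
        Finset.mem_univ _, rfl⟩
    · intro ω _
      rfl
  have h2 : ∀ ω : Quotient s → Bool, ∏ e, w e (ω (Quotient.mk s e)) =
      ∏ x, ∏ e with Quotient.mk s e = x, w e (ω x) := by
    intro ω
    rw [← Finset.prod_fiberwise (s := Finset.univ) (g := Quotient.mk s)]
    refine Finset.prod_congr rfl fun x _ => Finset.prod_congr rfl fun e he => ?_
    rw [(Finset.mem_filter.1 he).2]
  rw [h1]
  simp_rw [h2]
  have h3 := Finset.prod_univ_sum (fun _ : Quotient s => (Finset.univ : Finset Bool))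
    (fun x b => ∏ e with Quotient.mk s e = x, w e b)
  rw [Fintype.piFinset_univ] at h3
  rw [← h3, ← Finset.prod_fiberwise (s := Finset.univ) (g := Quotient.mk s)
    (f := fun e => if τ e = e then 1 else Real.exp (-(w e true * w e false)))]
  refine Finset.prod_le_prod
    (fun x _ => Finset.sum_nonneg fun b _ => Finset.prod_nonneg fun e _ => hw0 e b) ?_
  intro x _
  obtain ⟨e, rfl⟩ := Quotient.mk_surjective x
  have hmem : ∀ e', Quotient.mk s e' = Quotient.mk s e ↔ τ.SameCycle e' e :=
    fun e' => Quotient.eq (r := s)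
  have h4 : ∀ b, ∏ e' with Quotient.mk s e' = Quotient.mk s e, w e' b =
      w e b ^ #{e' | Quotient.mk s e' = Quotient.mk s e} := by
    intro b
    refine Finset.prod_eq_pow_card fun e' he' => ?_
    rw [Finset.mem_filter, hmem] at he'
    exact congrFun (hconst w hτ _ _ he'.2) b
  simp_rw [h4]
  by_cases he : τ e = e
  · have h5 : ({e' | Quotient.mk s e' = Quotient.mk s e} : Finset ι) = {e} := by
      ext e'
      rw [Finset.mem_filter, hmem, Finset.mem_singleton]
      refine ⟨fun h => h.2.eq_of_right he, fun h => ⟨Finset.mem_univ _, h ▸ .refl _ _⟩⟩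
    rw [h5]
    simp only [Finset.card_singleton, pow_one, Finset.prod_singleton, he, if_true]
    exact (hw e).le
  · have h5 : ∏ e' with Quotient.mk s e' = Quotient.mk s e,
        (if τ e' = e' then 1 else Real.exp (-(w e' true * w e' false))) =
        Real.exp (-(w e true * w e false)) ^ #{e' | Quotient.mk s e' = Quotient.mk s e} := by
      refine Finset.prod_eq_pow_card fun e' he' => ?_
      rw [Finset.mem_filter, hmem] at he'
      rw [if_neg, hconst w hτ _ _ he'.2]
      intro h
      have := he'.2.eq_of_left h
      exact he (this ▸ h)
    rw [h5, Fintype.sum_bool]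
    refine pow_add_pow_le_exp (hw0 e _) (hw0 e _) (by simpa using hw e) ?_
    have : 1 < #{e' | Quotient.mk s e' = Quotient.mk s e} := by
      rw [Finset.one_lt_card]
      refine ⟨τ e, ?_, e, ?_, he⟩
      · rw [Finset.mem_filter, hmem]
        exact ⟨Finset.mem_univ _, Equiv.Perm.sameCycle_apply_left.2 (.refl τ e)⟩
      · simp
    exact this

end ProductWeights

/-- The generating function of the sizes of the supports of the permutations. -/
theorem sum_perm_pow_card_support_le {V : Type*} [Fintype V] [DecidableEq V] {t : ℝ}
    (ht : 0 ≤ t) :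
    ∑ σ : Equiv.Perm V, t ^ #σ.support ≤ (1 + Fintype.card V * t) ^ Fintype.card V := by
  have h1 : ∀ σ : Equiv.Perm V, t ^ #σ.support = ∏ v, if σ v = v then 1 else t := by
    intro σ
    rw [Finset.prod_ite, Finset.prod_const_one, one_mul, Finset.prod_const]
    congr 2
  have h2 := Finset.prod_univ_sum (fun _ : V => (Finset.univ : Finset V))
    (fun v u => if u = v then 1 else t)
  rw [Fintype.piFinset_univ] at h2
  calc ∑ σ : Equiv.Perm V, t ^ #σ.support
      = ∑ f ∈ Finset.univ.map ⟨fun σ : Equiv.Perm V => (σ : V → V), DFunLike.coe_injective⟩,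
          ∏ v, (if f v = v then 1 else t) := by
        rw [Finset.sum_map]
        exact Finset.sum_congr rfl fun σ _ => h1 σ
    -- Enlarging the sum from permutations to all maps makes it factor over the vertices.
    _ ≤ ∑ f : V → V, ∏ v, (if f v = v then 1 else t) := by
        refine Finset.sum_le_sum_of_subset_of_nonneg (Finset.subset_univ _) fun f _ _ => ?_
        exact Finset.prod_nonneg fun v _ => by split_ifs <;> simp [ht]
    _ = ∏ v : V, ∑ u : V, (if u = v then 1 else t) := h2.symm
    _ ≤ ∏ _v : V, (1 + Fintype.card V * t) := by
        refine Finset.prod_le_prod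
          (fun v _ => Finset.sum_nonneg fun u _ => by split_ifs <;> simp [ht]) fun v _ => ?_
        calc ∑ u : V, (if u = v then 1 else t) ≤ ∑ u : V, ((if u = v then 1 else 0) + t) := by
              refine Finset.sum_le_sum fun u _ => ?_
              split_ifs <;> linarith
          _ = _ := by simp [Finset.sum_add_distrib]
    _ = _ := by simp

/-! ### Graphs as functions on the pairs of vertices -/

section Graphs

open scoped Classical

variable {V : Type} [Fintype V] {r : ℕ}

theorem mem_pairs {e : Sym2 V} : e ∈ pairs V ↔ ¬ e.IsDiag := by
  simp [pairs]

/-- The distribution of the indicator of the pair `e`. -/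
def pairWeight (c : V → Fin r) (p q : ℝ) (e : pairs V) (b : Bool) : ℝ :=
  if b then edgeProb c p q e else 1 - edgeProb c p q e

/-- The indicator function of the edge set. -/
def edgeIndicator (G : SimpleGraph V) (e : pairs V) : Bool :=
  decide (e.1 ∈ G.edgeSet)

theorem edgeIndicator_eq_true {G : SimpleGraph V} {e : pairs V} :
    edgeIndicator G e = true ↔ e.1 ∈ G.edgeSet := by
  simp [edgeIndicator]

theorem sum_pairWeight (c : V → Fin r) (p q : ℝ) (e : pairs V) :
    ∑ b, pairWeight c p q e b = 1 := by
  simp [pairWeight]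

omit [Fintype V] in
theorem edgeProb_mem_Icc (c : V → Fin r) {p q : ℝ} (hp : p ∈ Set.Icc (0 : ℝ) 1)
    (hq : q ∈ Set.Icc (0 : ℝ) 1) (e : Sym2 V) : edgeProb c p q e ∈ Set.Icc (0 : ℝ) 1 := by
  unfold edgeProb
  split_ifs <;> assumption

theorem pairWeight_nonneg (c : V → Fin r) {p q : ℝ} (hp : p ∈ Set.Icc (0 : ℝ) 1)
    (hq : q ∈ Set.Icc (0 : ℝ) 1) (e : pairs V) (b : Bool) : 0 ≤ pairWeight c p q e b := by
  have := edgeProb_mem_Icc c hp hq e.1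
  unfold pairWeight
  split_ifs
  · exact this.1
  · linarith [this.2]

theorem graphProb_eq_prod (c : V → Fin r) (p q : ℝ) (G : SimpleGraph V) :
    graphProb c p q G = ∏ e : pairs V, pairWeight c p q e (edgeIndicator G e) := by
  unfold graphProb
  rw [← Finset.prod_coe_sort]
  refine Finset.prod_congr rfl fun e _ => ?_
  simp [pairWeight, edgeIndicator]

theorem graphProb_nonneg (c : V → Fin r) {p q : ℝ} (hp : p ∈ Set.Icc (0 : ℝ) 1)
    (hq : q ∈ Set.Icc (0 : ℝ) 1) (G : SimpleGraph V) : 0 ≤ graphProb c p q G := by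
  rw [graphProb_eq_prod]
  exact Finset.prod_nonneg fun e _ => pairWeight_nonneg c hp hq e _

theorem edgeIndicator_bijective :
    Function.Bijective (edgeIndicator : SimpleGraph V → pairs V → Bool) := by
  constructor
  · intro G G' h
    rw [← SimpleGraph.edgeSet_inj]
    ext e
    by_cases he : e.IsDiag
    · exact iff_of_false (fun h => G.not_isDiag_of_mem_edgeSet h he)
        (fun h => G'.not_isDiag_of_mem_edgeSet h he)
    · have := congrFun h ⟨e, mem_pairs.2 he⟩
      simpa [edgeIndicator] using this
  · intro ω
    refine ⟨SimpleGraph.fromEdgeSet {e | ∃ h : e ∈ pairs V, ω ⟨e, h⟩ = true}, ?_⟩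
    funext e
    have he := mem_pairs.1 e.2
    rw [Bool.eq_iff_iff, edgeIndicator_eq_true, SimpleGraph.edgeSet_fromEdgeSet]
    constructor
    · rintro ⟨⟨_, h⟩, _⟩
      exact h
    · intro h
      exact ⟨⟨e.2, h⟩, he⟩

theorem sum_edgeIndicator (F : (pairs V → Bool) → ℝ) :
    ∑ G : SimpleGraph V, F (edgeIndicator G) = ∑ ω, F ω :=
  Fintype.sum_bijective _ edgeIndicator_bijective _ _ fun _ => rfl

/-- The action of a permutation of the vertices on the pairs. -/
def pairPerm (σ : Equiv.Perm V) : Equiv.Perm (pairs V) where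
  toFun e := ⟨Sym2.map σ e, by
    have := e.2
    rw [mem_pairs] at this ⊢
    rwa [Sym2.isDiag_map σ.injective]⟩
  invFun e := ⟨Sym2.map σ.symm e, by
    have := e.2
    rw [mem_pairs] at this ⊢
    rwa [Sym2.isDiag_map σ.symm.injective]⟩
  left_inv e := by
    apply Subtype.ext
    simp [Sym2.map_map]
  right_inv e := by
    apply Subtype.ext
    simp [Sym2.map_map]

theorem edgeIndicator_comap (G : SimpleGraph V) (σ : Equiv.Perm V) :
    edgeIndicator (G.comap σ) = edgeIndicator G ∘ pairPerm σ := by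
  funext ⟨e, he⟩
  induction e with
  | h u v => simp [edgeIndicator, pairPerm]

/-! ### Block-preserving permutations and their orbits -/

/-- The vertex permutations that preserve every block. -/
def preserving (c : V → Fin r) : Finset (Equiv.Perm V) := {σ | c ∘ σ = c}

theorem mem_preserving {c : V → Fin r} {σ : Equiv.Perm V} : σ ∈ preserving c ↔ c ∘ σ = c := by
  simp [preserving]

theorem one_mem_preserving (c : V → Fin r) : 1 ∈ preserving c :=
  mem_preserving.2 rfl

theorem mul_mem_preserving {c : V → Fin r} {σ τ : Equiv.Perm V} (hσ : σ ∈ preserving c)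
    (hτ : τ ∈ preserving c) : σ * τ ∈ preserving c := by
  rw [mem_preserving] at *
  rw [Equiv.Perm.coe_mul, ← Function.comp_assoc, hσ, hτ]

theorem inv_mem_preserving {c : V → Fin r} {σ : Equiv.Perm V} (hσ : σ ∈ preserving c) :
    σ⁻¹ ∈ preserving c := by
  rw [mem_preserving] at *
  funext v
  have := congrFun hσ (σ⁻¹ v)
  simpa using this.symm

theorem card_preserving (c : V → Fin r) :
    #(preserving c) = ∏ i, (#(block c i)).factorial := by
  have := DomMulAct.stabilizer_card c
  rw [Fintype.card_subtype] at this
  rw [preserving, this]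
  refine Finset.prod_congr rfl fun i _ => ?_
  rw [Fintype.card_subtype, block]

theorem edgeProb_map {c : V → Fin r} {σ : Equiv.Perm V} (hσ : σ ∈ preserving c) (p q : ℝ)
    (e : Sym2 V) : edgeProb c p q (e.map σ) = edgeProb c p q e := by
  rw [edgeProb, Sym2.map_map, mem_preserving.1 hσ, edgeProb]

theorem pairWeight_pairPerm {c : V → Fin r} {σ : Equiv.Perm V} (hσ : σ ∈ preserving c) (p q : ℝ)
    (e : pairs V) : pairWeight c p q (pairPerm σ e) = pairWeight c p q e := by
  funext b
  simp [pairWeight, pairPerm, edgeProb_map hσ]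

theorem graphProb_comap {c : V → Fin r} {σ : Equiv.Perm V} (hσ : σ ∈ preserving c) (p q : ℝ)
    (G : SimpleGraph V) : graphProb c p q (G.comap σ) = graphProb c p q G := by
  rw [graphProb_eq_prod, graphProb_eq_prod, edgeIndicator_comap]
  refine Fintype.prod_equiv (pairPerm σ) _ _ fun e => ?_
  rw [pairWeight_pairPerm hσ]
  rfl

omit [Fintype V] in
theorem comap_mul (G : SimpleGraph V) (σ τ : Equiv.Perm V) :
    G.comap (σ * τ : Equiv.Perm V) = (G.comap σ).comap τ := rfl

/-- This identifies structures with orbits of the block-preserving permutations acting by `comap`.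
-/
theorem structureOf_eq_iff {c : V → Fin r} {G G' : SimpleGraph V} :
    structureOf c G' = structureOf c G ↔ ∃ σ ∈ preserving c, G.comap σ = G' := by
  constructor
  · intro h
    obtain ⟨φ, hφ⟩ : ∃ φ : G' ≃g G, ∀ i, φ '' (block c i : Set V) = block c i :=
      Quotient.exact h
    refine ⟨φ.toEquiv, mem_preserving.2 ?_, ?_⟩
    · funext v
      have h1 : φ v ∈ φ '' (block c (c v) : Set V) := ⟨v, by simp [block], rfl⟩
      rw [hφ] at h1
      simpa [block] using h1
    · ext u v
      exact φ.map_rel_iff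
  · rintro ⟨σ, hσ, rfl⟩
    refine Quotient.sound ⟨⟨σ, Iff.rfl⟩, fun i => ?_⟩
    have h1 := congrFun (mem_preserving.1 hσ)
    have h2 := congrFun (mem_preserving.1 (inv_mem_preserving hσ))
    ext v
    simp only [block, Finset.coe_filter, Finset.mem_univ, true_and, Set.mem_image,
      Set.mem_ofPred_eq]
    constructor
    · rintro ⟨u, hu, rfl⟩
      exact (h1 u).trans hu
    · intro hv
      exact ⟨σ⁻¹ v, (h2 v).trans hv, Equiv.apply_symm_apply σ v⟩

/-- The partition-preserving automorphisms of a graph. -/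
def autos (c : V → Fin r) (G : SimpleGraph V) : Finset (Equiv.Perm V) :=
  {σ ∈ preserving c | G.comap σ = G}

theorem one_mem_autos (c : V → Fin r) (G : SimpleGraph V) : 1 ∈ autos c G :=
  Finset.mem_filter.2 ⟨one_mem_preserving c, rfl⟩

theorem one_le_card_autos (c : V → Fin r) (G : SimpleGraph V) : (1 : ℝ) ≤ #(autos c G) := by
  exact_mod_cast Finset.card_pos.2 ⟨1, one_mem_autos c G⟩

/-- The labeled graphs with the same structure as `G`. -/
def isoClass (c : V → Fin r) (G : SimpleGraph V) : Finset (SimpleGraph V) :=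
  {G' | structureOf c G' = structureOf c G}

theorem mem_isoClass {c : V → Fin r} {G G' : SimpleGraph V} :
    G' ∈ isoClass c G ↔ structureOf c G' = structureOf c G := by
  simp [isoClass]

/-- Orbit–stabilizer: the fibers of σ ↦ `G.comap σ` are cosets of the automorphism group. -/
theorem card_isoClass_mul_card_autos (c : V → Fin r) (G : SimpleGraph V) :
    #(isoClass c G) * #(autos c G) = ∏ i, (#(block c i)).factorial := by
  rw [← card_preserving, Finset.card_eq_sum_card_fiberwise
    (f := fun σ : Equiv.Perm V => G.comap σ) (s := preserving c) (t := isoClass c G),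
    Finset.sum_const_nat]
  · intro G' hG'
    obtain ⟨σ, hσ, rfl⟩ := structureOf_eq_iff.1 (mem_isoClass.1 hG')
    refine (Finset.card_bij (fun τ _ => τ * σ) ?_ ?_ ?_).symm
    · intro τ hτ
      rw [autos, Finset.mem_filter] at hτ
      rw [Finset.mem_filter]
      refine ⟨mul_mem_preserving hτ.1 hσ, ?_⟩
      rw [comap_mul, hτ.2]
    · intro τ _ τ' _ h
      exact mul_right_cancel h
    · intro τ hτ
      rw [Finset.mem_filter] at hτ
      refine ⟨τ * σ⁻¹, ?_, by simp⟩
      rw [autos, Finset.mem_filter]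
      refine ⟨mul_mem_preserving hτ.1 (inv_mem_preserving hσ), ?_⟩
      rw [comap_mul, hτ.2, ← comap_mul, mul_inv_cancel]
      rfl
  · intro σ hσ
    exact mem_isoClass.2 (structureOf_eq_iff.2 ⟨σ, hσ, rfl⟩)

theorem structProb_structureOf (c : V → Fin r) (p q : ℝ) (G : SimpleGraph V) :
    structProb c p q (structureOf c G) = #(isoClass c G) * graphProb c p q G := by
  rw [structProb, ← nsmul_eq_mul]
  refine Finset.sum_eq_card_nsmul fun G' hG' => ?_
  obtain ⟨σ, hσ, rfl⟩ := structureOf_eq_iff.1 (Finset.mem_filter.1 hG').2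
  exact graphProb_comap hσ p q G

theorem sum_structProb_mul (c : V → Fin r) (p q : ℝ) (F : Structure c → ℝ) :
    ∑ S, structProb c p q S * F S = ∑ G, graphProb c p q G * F (structureOf c G) := by
  rw [← Finset.sum_fiberwise (s := Finset.univ) (g := structureOf c)]
  refine Finset.sum_congr rfl fun S _ => ?_
  rw [structProb, Finset.sum_mul]
  refine Finset.sum_congr rfl fun G hG => ?_
  rw [(Finset.mem_filter.1 hG).2]

theorem prob_eq_sum_graphProb (c : V → Fin r) (p q : ℝ) (A : Set (Structure c)) :
    prob c p q A = ∑ G with structureOf c G ∈ A, graphProb c p q G := by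
  have := sum_structProb_mul c p q (fun S => if S ∈ A then 1 else 0)
  simp only [mul_ite, mul_one, mul_zero] at this
  rw [prob, Finset.sum_filter, this, Finset.sum_filter]

/-! ### Entropy in terms of automorphisms -/

/-- The expected logarithm of the number of partition-preserving automorphisms. -/
def meanLogAutos (c : V → Fin r) (p q : ℝ) : ℝ :=
  ∑ G, graphProb c p q G * Real.logb 2 #(autos c G)

/-- The logarithm of the probability of a graph. -/
def logProb (c : V → Fin r) (p q : ℝ) (G : SimpleGraph V) : ℝ :=
  ∑ e, Real.logb 2 (pairWeight c p q e (edgeIndicator G e))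

/-- The logarithm of (orbit size) × P(G). Nonvanishing is needed to split the product, since
`Real.logb 2 0 = 0`; graphs of probability zero drop out of every weighted sum. -/
theorem logb_structProb (c : V → Fin r) (p q : ℝ) {G : SimpleGraph V}
    (hG : graphProb c p q G ≠ 0) :
    Real.logb 2 (structProb c p q (structureOf c G)) =
      logProb c p q G + logFactorials c - Real.logb 2 #(autos c G) := by
  have h1 : (#(autos c G) : ℝ) ≠ 0 := by linarith [one_le_card_autos c G]
  have h2 : (#(isoClass c G) : ℝ) ≠ 0 := by
    exact_mod_cast (Finset.card_pos.2 ⟨G, mem_isoClass.2 rfl⟩).ne'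
  have h3 : (#(isoClass c G) : ℝ) * #(autos c G) = ∏ i, ((#(block c i)).factorial : ℝ) := by
    exact_mod_cast card_isoClass_mul_card_autos c G
  have h4 : Real.logb 2 #(isoClass c G) + Real.logb 2 #(autos c G) = logFactorials c := by
    rw [← Real.logb_mul h2 h1, h3, Real.logb_prod]
    · rfl
    · intro i _
      exact_mod_cast (Nat.factorial_pos _).ne'
  have h5 : Real.logb 2 (graphProb c p q G) = logProb c p q G := by
    rw [graphProb_eq_prod, Real.logb_prod]
    · rfl
    · rw [graphProb_eq_prod, Finset.prod_ne_zero_iff] at hG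
      exact hG
  rw [structProb_structureOf, Real.logb_mul h2 hG, h5]
  linarith

theorem structuralEntropy_structProb (c : V → Fin r) (p q : ℝ) :
    structuralEntropy c (structProb c p q) = -∑ G, graphProb c p q G * logProb c p q G -
      logFactorials c + meanLogAutos c p q := by
  rw [structuralEntropy, meanLogAutos, sum_structProb_mul]
  have h1 : ∀ G, graphProb c p q G * Real.logb 2 (structProb c p q (structureOf c G)) =
      graphProb c p q G * logProb c p q G + graphProb c p q G * logFactorials c -
        graphProb c p q G * Real.logb 2 #(autos c G) := by
    intro G
    by_cases hG : graphProb c p q G = 0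
    · simp [hG]
    · rw [logb_structProb c p q hG]
      ring
  have h2 : ∑ G, graphProb c p q G = 1 := sum_graphProb c p q
  simp_rw [h1]
  rw [Finset.sum_sub_distrib, Finset.sum_add_distrib, ← Finset.sum_mul, h2]
  ring

/-! ### Counting pairs -/

theorem card_pairs : #(pairs V) = (Fintype.card V).choose 2 := by
  rw [← Sym2.card_subtype_not_diag, Fintype.card_subtype, pairs]

theorem card_pairs_within (c : V → Fin r) :
    (#{e : pairs V | (e.1.map c).IsDiag} : ℝ) = z c := by
  have h0 : #{e : pairs V | (e.1.map c).IsDiag} = #{e ∈ pairs V | (e.map c).IsDiag} := by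
    refine Finset.card_bij (fun e _ => e.1) ?_ ?_ ?_
    · intro e he
      simpa [e.2] using he
    · intro e _ e' _ h
      exact Subtype.ext h
    · intro e he
      rw [Finset.mem_filter] at he
      exact ⟨⟨e, he.1⟩, by simpa using he.2, rfl⟩
  have h1 : ({e ∈ pairs V | (e.map c).IsDiag} : Finset (Sym2 V)) =
      Finset.univ.biUnion fun i => (block c i).offDiag.image Sym2.mk.uncurry := by
    ext e
    induction e with
    | h u v =>
      simp only [Finset.mem_filter, mem_pairs, Finset.mem_biUnion, Finset.mem_univ, true_and,
        Finset.mem_image, Finset.mem_offDiag, block, Sym2.map_mk, Sym2.mk_isDiag_iff]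
      constructor
      · rintro ⟨h, h'⟩
        exact ⟨c u, (u, v), ⟨rfl, h'.symm, h⟩, rfl⟩
      · rintro ⟨i, ⟨a, b⟩, ⟨ha, hb, hab⟩, h⟩
        simp only [Function.uncurry, Sym2.eq_iff] at h ha hb hab
        rcases h with ⟨rfl, rfl⟩ | ⟨rfl, rfl⟩
        · exact ⟨hab, ha.trans hb.symm⟩
        · exact ⟨fun h => hab h.symm, hb.trans ha.symm⟩
  rw [h0, h1, Finset.card_biUnion]
  · rw [z]
    push_cast
    refine Finset.sum_congr rfl fun i _ => ?_
    norm_cast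
    exact Sym2.card_image_offDiag _
  · intro i _ j _ hij
    rw [Function.onFun, Finset.disjoint_left]
    intro e he he'
    simp only [Finset.mem_image, Finset.mem_offDiag, block, Finset.mem_filter, Finset.mem_univ,
      true_and] at he he'
    obtain ⟨⟨a, b⟩, ⟨ha, hb, -⟩, rfl⟩ := he
    obtain ⟨⟨a', b'⟩, ⟨ha', hb', -⟩, h⟩ := he'
    simp only [Function.uncurry, Sym2.eq_iff] at h ha hb ha' hb'
    rcases h with ⟨rfl, rfl⟩ | ⟨rfl, rfl⟩
    · exact hij (ha.symm.trans ha')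
    · exact hij (hb.symm.trans ha')

/-- Each pair contributes minus its own binary entropy. The value `Real.logb 2 0 = 0` keeps this
exact when p or q is 0 or 1. -/
theorem sum_graphProb_mul_logProb (c : V → Fin r) (p q : ℝ) :
    ∑ G, graphProb c p q G * logProb c p q G =
      -(z c * (h p - h q) + ((Fintype.card V).choose 2 : ℝ) * h q) := by
  have h1 := sum_prod_mul_sum (pairWeight c p q) (sum_pairWeight c p q)
    (fun e b => Real.logb 2 (pairWeight c p q e b))
  rw [← sum_edgeIndicator] at h1
  simp_rw [graphProb_eq_prod]
  refine h1.trans ?_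
  have h2 : ∀ e : pairs V, ∑ b, pairWeight c p q e b * Real.logb 2 (pairWeight c p q e b) =
      (if (e.1.map c).IsDiag then h q - h p else 0) + -h q := by
    intro e
    by_cases he : (e.1.map c).IsDiag <;> simp [pairWeight, edgeProb, h, he] <;> ring
  simp_rw [h2]
  rw [Finset.sum_add_distrib, ← Finset.sum_filter, Finset.sum_const, Finset.sum_const,
    nsmul_eq_mul, nsmul_eq_mul, card_pairs_within, Finset.card_univ, Fintype.card_coe, card_pairs]
  ring

/-! ### Automorphisms -/

/-- Double counting: let u be moved and v lie in its block with v ≠ u, σ u. Then σ moves the pair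
{u, v}, since σ u is neither u nor v. Each u has at least m - 2 such v, and each unordered pair
arises at most twice. -/
theorem mul_card_support_le_card_moved {c : V → Fin r} {σ : Equiv.Perm V}
    {m : ℝ} (hm : ∀ i, m ≤ #(block c i)) :
    (m - 2) * #σ.support ≤
      2 * #{e : pairs V | (e.1.map c).IsDiag ∧ pairPerm σ e ≠ e} := by
  set T : Finset (V × V) := {x | σ x.1 ≠ x.1 ∧ c x.2 = c x.1 ∧ x.2 ≠ x.1 ∧ x.2 ≠ σ x.1} with hT
  have h0 : #{e : pairs V | (e.1.map c).IsDiag ∧ pairPerm σ e ≠ e} =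
      #{e ∈ pairs V | (e.map c).IsDiag ∧ e.map σ ≠ e} := by
    refine Finset.card_bij (fun e _ => e.1) ?_ ?_ ?_
    · intro e he
      simpa [e.2, pairPerm, Subtype.ext_iff] using he
    · intro e _ e' _ h
      exact Subtype.ext h
    · intro e he
      rw [Finset.mem_filter] at he
      exact ⟨⟨e, he.1⟩, by simpa [pairPerm, Subtype.ext_iff] using he.2, rfl⟩
  have h1 : #T ≤ 2 * #{e ∈ pairs V | (e.map c).IsDiag ∧ e.map σ ≠ e} := by
    refine Finset.card_le_mul_card_image_of_maps_to (f := Sym2.mk.uncurry) ?_ 2 ?_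
    · rintro ⟨u, v⟩ h
      simp only [hT, Finset.mem_filter, Finset.mem_univ, true_and] at h
      simp only [Finset.mem_filter, mem_pairs, Function.uncurry, Sym2.map_mk, Sym2.mk_isDiag_iff]
      refine ⟨h.2.2.1.symm, h.2.1.symm, fun h' => ?_⟩
      rw [Sym2.eq_iff] at h'
      rcases h' with h' | h'
      · exact h.1 h'.1
      · exact h.2.2.2 h'.1.symm
    · intro e _
      induction e with
      | h u v =>
        refine (Finset.card_le_card (t := {(u, v), (v, u)}) ?_).trans Finset.card_le_two
        rintro ⟨a, b⟩ hab
        simp only [Finset.mem_filter, Function.uncurry, Sym2.eq_iff] at hab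
        simpa using hab.2
  have h2 : (m - 2) * #σ.support ≤ #T := by
    have h3 : #T = ∑ u ∈ σ.support, #{v | c v = c u ∧ v ≠ u ∧ v ≠ σ u} := by
      rw [Finset.card_eq_sum_card_fiberwise (f := Prod.fst) (t := σ.support)]
      · refine Finset.sum_congr rfl fun u hu => ?_
        rw [Equiv.Perm.mem_support] at hu
        refine Finset.card_bij (fun x _ => x.2) ?_ ?_ ?_
        · rintro ⟨a, b⟩ hx
          simp only [hT, Finset.mem_filter, Finset.mem_univ, true_and] at hx ⊢
          obtain ⟨hx, rfl⟩ := hx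
          exact hx.2
        · rintro ⟨a, b⟩ hx ⟨a', b'⟩ hx' hb
          rw [Finset.mem_filter] at hx hx'
          exact Prod.ext (hx.2.trans hx'.2.symm) hb
        · intro v hv
          refine ⟨(u, v), ?_, rfl⟩
          simp only [hT, Finset.mem_filter, Finset.mem_univ, true_and] at hv ⊢
          exact ⟨⟨hu, hv⟩, trivial⟩
      · intro x hx
        simp only [hT, Finset.coe_filter, Set.mem_ofPred_eq, Finset.mem_univ, true_and] at hx
        simpa using hx.1
    rw [h3, mul_comm, ← nsmul_eq_mul]
    push_cast
    refine Finset.card_nsmul_le_sum _ _ _ fun u _ => ?_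
    have h4 : block c (c u) ⊆
        ({v | c v = c u ∧ v ≠ u ∧ v ≠ σ u} : Finset V) ∪ {u, σ u} := by
      intro v hv
      simp only [block, Finset.mem_filter, Finset.mem_univ, true_and] at hv
      simp only [Finset.mem_union, Finset.mem_filter, Finset.mem_univ, true_and, hv,
        Finset.mem_insert, Finset.mem_singleton]
      tauto
    have h5 : #(block c (c u)) ≤ #{v | c v = c u ∧ v ≠ u ∧ v ≠ σ u} + 2 :=
      (Finset.card_le_card h4).trans ((Finset.card_union_le _ _).trans
        (Nat.add_le_add_left Finset.card_le_two _))
    have h6 : (#(block c (c u)) : ℝ) ≤ #{v | c v = c u ∧ v ≠ u ∧ v ≠ σ u} + 2 := by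
      exact_mod_cast h5
    linarith [hm (c u)]
  rw [h0]
  exact h2.trans (by exact_mod_cast h1)

/-- In the cycle bound, fixed pairs and pairs across blocks are estimated by 1. Every moved pair
inside a block gives exp(-p(1-p)), and the double count bounds their number below. -/
theorem sum_graphProb_comap_eq_le {c : V → Fin r} {p q : ℝ} (hp : p ∈ Set.Icc (0 : ℝ) 1)
    (hq : q ∈ Set.Icc (0 : ℝ) 1) {m : ℝ} (hm : ∀ i, m ≤ #(block c i)) {σ : Equiv.Perm V}
    (hσ : σ ∈ preserving c) :
    ∑ G : SimpleGraph V with G.comap σ = G, graphProb c p q G ≤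
      Real.exp (-(p * (1 - p) * ((m - 2) / 2))) ^ #σ.support := by
  have h1 := sum_invariant_le (pairPerm σ) (pairWeight c p q) (sum_pairWeight c p q)
    (pairWeight_nonneg c hp hq) (pairWeight_pairPerm hσ p q)
  have h2 : ∑ G : SimpleGraph V with G.comap σ = G, graphProb c p q G =
      ∑ ω : pairs V → Bool with ω ∘ pairPerm σ = ω, ∏ e, pairWeight c p q e (ω e) := by
    rw [Finset.sum_filter, Finset.sum_filter, ← sum_edgeIndicator]
    refine Finset.sum_congr rfl fun G _ => ?_
    simp only [← edgeIndicator_comap, edgeIndicator_bijective.1.eq_iff, graphProb_eq_prod]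
  rw [h2]
  refine h1.trans ?_
  have h3 : ∀ e : pairs V, (if pairPerm σ e = e then (1 : ℝ)
      else Real.exp (-(pairWeight c p q e true * pairWeight c p q e false))) ≤
      if (e.1.map c).IsDiag ∧ pairPerm σ e ≠ e then Real.exp (-(p * (1 - p))) else 1 := by
    intro e
    by_cases h4 : pairPerm σ e = e
    · simp [h4]
    · by_cases h5 : (e.1.map c).IsDiag
      · simp [h4, h5, pairWeight, edgeProb]
      · simp only [h4, if_false, h5, false_and]
        rw [Real.exp_le_one_iff, neg_nonpos]
        exact mul_nonneg (pairWeight_nonneg c hp hq _ _) (pairWeight_nonneg c hp hq _ _)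
  refine (Finset.prod_le_prod (fun e _ => by split_ifs <;> positivity) fun e _ => h3 e).trans ?_
  rw [Finset.prod_ite, Finset.prod_const_one, mul_one, Finset.prod_const, ← Real.exp_nat_mul,
    ← Real.exp_nat_mul, Real.exp_le_exp]
  have h4 := mul_card_support_le_card_moved (σ := σ) hm
  have h5 : 0 ≤ p * (1 - p) := mul_nonneg hp.1 (by linarith [hp.2])
  nlinarith

/-- The expected number of nontrivial partition-preserving automorphisms. -/
theorem sum_graphProb_mul_card_autos_sub_one_le {c : V → Fin r} {p q : ℝ}
    (hp : p ∈ Set.Icc (0 : ℝ) 1) (hq : q ∈ Set.Icc (0 : ℝ) 1) {m : ℝ}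
    (hm : ∀ i, m ≤ #(block c i)) :
    ∑ G, graphProb c p q G * (#(autos c G) - 1) ≤
      Real.exp (Fintype.card V * (Fintype.card V *
        Real.exp (-(p * (1 - p) * ((m - 2) / 2))))) - 1 := by
  set t := Real.exp (-(p * (1 - p) * ((m - 2) / 2))) with ht
  -- Exchanging the sums turns the mean number of automorphisms into a sum of fixing probabilities.
  have h1 : ∑ G, graphProb c p q G * #(autos c G) =
      ∑ σ ∈ preserving c, ∑ G : SimpleGraph V with G.comap σ = G, graphProb c p q G := by
    simp_rw [autos, Finset.card_filter, Finset.sum_filter]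
    rw [Finset.sum_comm]
    refine Finset.sum_congr rfl fun G _ => ?_
    push_cast
    rw [Finset.mul_sum]
    refine Finset.sum_congr rfl fun σ _ => ?_
    split_ifs <;> simp
  have h2 : ∑ G, graphProb c p q G * #(autos c G) ≤
      (1 + Fintype.card V * t) ^ Fintype.card V := by
    rw [h1]
    calc _ ≤ ∑ σ ∈ preserving c, t ^ #σ.support :=
          Finset.sum_le_sum fun σ hσ => sum_graphProb_comap_eq_le hp hq hm hσ
      _ ≤ ∑ σ : Equiv.Perm V, t ^ #σ.support :=
          Finset.sum_le_sum_of_subset_of_nonneg (Finset.subset_univ _) fun σ _ _ => by positivity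
      _ ≤ _ := sum_perm_pow_card_support_le (Real.exp_pos _).le
  have h3 : (1 + Fintype.card V * t) ^ Fintype.card V ≤
      Real.exp (Fintype.card V * (Fintype.card V * t)) := by
    rw [Real.exp_nat_mul]
    have : 0 ≤ t := (Real.exp_pos _).le
    gcongr
    rw [add_comm]
    exact Real.add_one_le_exp _
  have h4 : ∑ G, graphProb c p q G = 1 := sum_graphProb c p q
  simp_rw [mul_sub, mul_one]
  rw [Finset.sum_sub_distrib, h4]
  linarith

theorem logb_card_autos_nonneg (c : V → Fin r) (G : SimpleGraph V) :
    0 ≤ Real.logb 2 #(autos c G) :=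
  Real.logb_nonneg one_lt_two (one_le_card_autos c G)

theorem meanLogAutos_nonneg (c : V → Fin r) {p q : ℝ} (hp : p ∈ Set.Icc (0 : ℝ) 1)
    (hq : q ∈ Set.Icc (0 : ℝ) 1) : 0 ≤ meanLogAutos c p q :=
  Finset.sum_nonneg fun G _ => mul_nonneg (graphProb_nonneg c hp hq G)
    (logb_card_autos_nonneg c G)

/-- Apply log a ≤ a - 1 under the expectation. -/
theorem meanLogAutos_le {c : V → Fin r} {p q : ℝ}
    (hp : p ∈ Set.Icc (0 : ℝ) 1) (hq : q ∈ Set.Icc (0 : ℝ) 1) {m : ℝ}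
    (hm : ∀ i, m ≤ #(block c i)) :
    meanLogAutos c p q ≤
      (Real.exp (Fintype.card V * (Fintype.card V *
        Real.exp (-(p * (1 - p) * ((m - 2) / 2))))) - 1) / Real.log 2 := by
  refine le_trans ?_ (div_le_div_of_nonneg_right
    (sum_graphProb_mul_card_autos_sub_one_le (q := q) hp hq hm) (Real.log_pos one_lt_two).le)
  rw [meanLogAutos, Finset.sum_div]
  refine Finset.sum_le_sum fun G _ => ?_
  rw [mul_div_assoc]
  refine mul_le_mul_of_nonneg_left ?_ (graphProb_nonneg c hp hq G)
  rw [Real.logb]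
  refine div_le_div_of_nonneg_right (Real.log_le_sub_one_of_pos ?_) (Real.log_pos one_lt_two).le
  linarith [one_le_card_autos c G]

/-! ### Concentration of the log-probability -/

/-- Square |√x log √x| < 1, where log √x = (log x)/2. This makes the variance bound uniform in p and
q. -/
theorem mul_log_sq_le {x : ℝ} (h0 : 0 ≤ x) (h1 : x ≤ 1) : x * Real.log x ^ 2 ≤ 4 := by
  rcases h0.eq_or_lt with rfl | h0
  · simp
  have h2 := Real.abs_log_mul_self_lt (√x) (Real.sqrt_pos.2 h0) (Real.sqrt_le_one.2 h1)
  have h3 : Real.log (√x) = Real.log x / 2 := Real.log_sqrt h0.le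
  have h4 : (Real.log (√x) * √x) ^ 2 < 1 := by
    rw [sq_lt_one_iff_abs_lt_one]
    exact h2
  rw [mul_pow, Real.sq_sqrt h0.le, h3] at h4
  linarith

/-- Each pair has second moment at most 8/ln² 2, that is 4/ln² 2 for each of its two states. -/
theorem variance_logProb_le (c : V → Fin r) {p q : ℝ} (hp : p ∈ Set.Icc (0 : ℝ) 1)
    (hq : q ∈ Set.Icc (0 : ℝ) 1) :
    ∑ G, graphProb c p q G * (logProb c p q G +
      (z c * (h p - h q) + ((Fintype.card V).choose 2 : ℝ) * h q)) ^ 2 ≤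
      ((Fintype.card V).choose 2 : ℝ) * (8 / Real.log 2 ^ 2) := by
  have h1 := variance_sum_le (pairWeight c p q) (sum_pairWeight c p q)
    (fun e b => Real.logb 2 (pairWeight c p q e b))
  have h2 := sum_graphProb_mul_logProb c p q
  have h3 := sum_prod_mul_sum (pairWeight c p q) (sum_pairWeight c p q)
    (fun e b => Real.logb 2 (pairWeight c p q e b))
  have h4 : ∑ G, graphProb c p q G * logProb c p q G =
      ∑ e, ∑ b, pairWeight c p q e b * Real.logb 2 (pairWeight c p q e b) := by
    rw [← h3, ← sum_edgeIndicator]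
    simp_rw [graphProb_eq_prod]
    rfl
  rw [← h4, h2, ← sum_edgeIndicator] at h1
  simp_rw [sub_neg_eq_add] at h1
  simp_rw [graphProb_eq_prod]
  refine le_trans h1 ?_
  rw [← card_pairs, ← nsmul_eq_mul, ← Fintype.card_coe, ← Finset.card_univ]
  refine Finset.sum_le_card_nsmul _ _ _ fun e _ => ?_
  have h5 : ∀ b, pairWeight c p q e b * Real.logb 2 (pairWeight c p q e b) ^ 2 ≤
      4 / Real.log 2 ^ 2 := by
    intro b
    have h6 : pairWeight c p q e b ≤ 1 := by
      rw [← sum_pairWeight c p q e]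
      exact Finset.single_le_sum (fun b _ => pairWeight_nonneg c hp hq e b) (Finset.mem_univ b)
    rw [Real.logb, div_pow, ← mul_div_assoc]
    exact div_le_div_of_nonneg_right (mul_log_sq_le (pairWeight_nonneg c hp hq e b) h6)
      (sq_nonneg _)
  rw [Fintype.sum_bool]
  refine (add_le_add (h5 true) (h5 false)).trans (le_of_eq ?_)
  ring

end Graphs

/-! ### The asymptotic equipartition property -/

section Concentration

open scoped Classical

variable {V : Type} [Fintype V] {r : ℕ}

/-- The asymptotic equipartition bound, from the inequalities of Chebyshev and Markov. -/
theorem one_sub_le_prob {c : V → Fin r} {p q : ℝ} (hp : p ∈ Set.Icc (0 : ℝ) 1)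
    (hq : q ∈ Set.Icc (0 : ℝ) 1) {ε δ L M : ℝ} (hε : 0 < ε) (hM : 0 < M)
    (hMV : ((Fintype.card V).choose 2 : ℝ) = M) (hL : |L - logFactorials c| ≤ ε * M)
    (hδ : meanLogAutos c p q ≤ δ) :
    1 - M * (8 / Real.log 2 ^ 2) / (ε * M) ^ 2 - δ / (ε * M) ≤ prob c p q {S |
      |-(1 / M) * Real.logb 2 (structProb c p q S) - z c / M * (h p - h q) - h q + L / M|
        < 3 * ε} := by
  set A : Set (Structure c) := {S |
      |-(1 / M) * Real.logb 2 (structProb c p q S) - z c / M * (h p - h q) - h q + L / M|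
        < 3 * ε} with hA
  set μ := z c * (h p - h q) + M * h q with hμ
  have hεM : 0 < ε * M := mul_pos hε hM
  have h0 : ∑ G, graphProb c p q G = 1 := sum_graphProb c p q
  rw [← Finset.sum_filter_add_sum_filter_not _ (fun G => structureOf c G ∈ A),
    ← prob_eq_sum_graphProb] at h0
  -- Outside the event, a graph of positive probability makes the bracket at least 1. Otherwise the
  -- deviation of log P(G), the change of Λ and log a(G) would each be at most εM, the first and
  -- last strictly, so the total would stay below 3εM.
  have h1 : ∑ G with structureOf c G ∉ A, graphProb c p q G ≤
      ∑ G, graphProb c p q G * ((logProb c p q G + μ) ^ 2 / (ε * M) ^ 2 +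
        Real.logb 2 #(autos c G) / (ε * M)) := by
    rw [Finset.sum_filter]
    refine Finset.sum_le_sum fun G _ => ?_
    have hP := graphProb_nonneg c hp hq G
    have hlog := logb_card_autos_nonneg c G
    split_ifs with hG
    · positivity
    · by_cases hP0 : graphProb c p q G = 0
      · simp [hP0]
      refine le_mul_of_one_le_right hP ?_
      by_contra! hlt
      refine hG ?_
      have h2 : (logProb c p q G + μ) ^ 2 / (ε * M) ^ 2 < 1 := by
        have : 0 ≤ Real.logb 2 #(autos c G) / (ε * M) := by positivity
        linarith
      have h3 : Real.logb 2 #(autos c G) / (ε * M) < 1 := by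
        have : 0 ≤ (logProb c p q G + μ) ^ 2 / (ε * M) ^ 2 := by positivity
        linarith
      rw [div_lt_one (by positivity)] at h2 h3
      have h4 := abs_lt.1 (abs_lt_of_sq_lt_sq h2 hεM.le)
      have h5 := abs_le.1 hL
      rw [hA, Set.mem_ofPred_eq, logb_structProb c p q hP0]
      have h6 : -(1 / M) * (logProb c p q G + logFactorials c - Real.logb 2 #(autos c G)) -
          z c / M * (h p - h q) - h q + L / M =
          (-(logProb c p q G + μ) + (L - logFactorials c) + Real.logb 2 #(autos c G)) / M := by
        rw [hμ]
        field_simp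
        ring
      rw [h6, abs_div, abs_of_pos hM, div_lt_iff₀ hM, abs_lt]
      constructor <;> linarith [h4.1, h4.2, h5.1, h5.2]
  have h2 : ∑ G, graphProb c p q G * ((logProb c p q G + μ) ^ 2 / (ε * M) ^ 2 +
      Real.logb 2 #(autos c G) / (ε * M)) =
      (∑ G, graphProb c p q G * (logProb c p q G + μ) ^ 2) / (ε * M) ^ 2 +
        meanLogAutos c p q / (ε * M) := by
    rw [meanLogAutos, Finset.sum_div, Finset.sum_div, ← Finset.sum_add_distrib]
    exact Finset.sum_congr rfl fun G _ => by ring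
  have h3 := variance_logProb_le c hp hq
  rw [hMV] at h3
  have h4 : (∑ G, graphProb c p q G * (logProb c p q G + μ) ^ 2) / (ε * M) ^ 2 ≤
      M * (8 / Real.log 2 ^ 2) / (ε * M) ^ 2 := div_le_div_of_nonneg_right h3 (sq_nonneg _)
  have h5 := div_le_div_of_nonneg_right hδ hεM.le
  linarith

end Concentration

/-! ### Asymptotics -/

/-- One of p, 1-p is at least 1/2, so p(1-p) is at least half the other and dominates ln n / n. The
power n⁻³ beats the later factor n² with 1/n to spare. In the exponent, -1 is the rounding of block
sizes and -2 the two excluded vertices. -/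
theorem eventually_exp_le {p : ℕ → ℝ} (hp : ∀ n, p n ∈ Set.Icc (0 : ℝ) 1)
    (hp_large : (fun n : ℕ => Real.log n / n) =o[atTop] p)
    (hp_small : (fun n : ℕ => Real.log n / n) =o[atTop] (fun n => 1 - p n)) {ξ : ℝ}
    (hξ : 0 < ξ) :
    ∀ᶠ n : ℕ in atTop,
      Real.exp (-(p n * (1 - p n) * ((ξ * n - 1 - 2) / 2))) ≤ 1 / (n : ℝ) ^ 3 := by
  -- Passing to p(1-p) turns ξ/24 into ξ/12. For n ≥ 6/ξ the block bound is at least ξn/2, so the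
  -- exponent is at least p(1-p)ξn/4 ≥ 3 ln n.
  have hδ : 0 < ξ / 24 := by positivity
  filter_upwards [hp_large.bound hδ, hp_small.bound hδ,
    tendsto_natCast_atTop_atTop.eventually_ge_atTop (6 / ξ), eventually_ge_atTop 1]
    with n h1 h2 h3 h4
  have hn : (1 : ℝ) ≤ n := by exact_mod_cast h4
  have hn0 : (0 : ℝ) < n := by linarith
  have hlog : 0 ≤ Real.log n := Real.log_nonneg hn
  have hp0 := (hp n).1
  have hp1 : 0 ≤ 1 - p n := by linarith [(hp n).2]
  rw [Real.norm_of_nonneg (by positivity), Real.norm_of_nonneg (by assumption)] at h1 h2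
  set y := Real.log n / n with hy
  have hy0 : 0 ≤ y := by positivity
  have h5 : y ≤ ξ / 12 * (p n * (1 - p n)) := by
    rcases le_total (p n) (1 / 2) with h | h
    · nlinarith [mul_nonneg hξ.le (mul_nonneg hp0 (by linarith : 0 ≤ 1 / 2 - p n))]
    · nlinarith [mul_nonneg hξ.le (mul_nonneg hp1 (by linarith : 0 ≤ p n - 1 / 2))]
  have h6 : ξ * n / 2 ≤ ξ * n - 1 - 2 := by
    rw [div_le_iff₀ hξ] at h3
    linarith
  have h7 : 3 * Real.log n ≤ p n * (1 - p n) * ((ξ * n - 1 - 2) / 2) := by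
    have h8 : Real.log n = y * n := by rw [hy]; field_simp
    calc 3 * Real.log n = 3 * (y * n) := by rw [h8]
      _ ≤ 3 * (ξ / 12 * (p n * (1 - p n)) * n) := by gcongr
      _ = p n * (1 - p n) * (ξ * n / 2 / 2) := by ring
      _ ≤ _ := by gcongr
  calc _ ≤ Real.exp (-(3 * Real.log n)) := Real.exp_le_exp.2 (by linarith)
    _ = 1 / (n : ℝ) ^ 3 := by
      rw [Real.exp_neg, one_div]
      congr 1
      have := Real.exp_nat_mul (Real.log n) 3
      rw [Real.exp_log hn0] at this
      exact_mod_cast this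

theorem eventually_meanLogAutos_le {r : ℕ} {x : Fin r → ℝ}
    (hx : ∀ i, x i ∈ Set.Ioo (0 : ℝ) 1) {p q : ℕ → ℝ}
    (hp : ∀ n, p n ∈ Set.Icc (0 : ℝ) 1) (hq : ∀ n, q n ∈ Set.Icc (0 : ℝ) 1)
    (hp_large : (fun n : ℕ => Real.log n / n) =o[atTop] p)
    (hp_small : (fun n : ℕ => Real.log n / n) =o[atTop] (fun n => 1 - p n)) :
    ∀ᶠ n : ℕ in atTop, ∀ c : Fin n → Fin r, (∀ i, |(#(block c i) : ℝ) - x i * n| < 1) →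
      meanLogAutos c (p n) (q n) ≤ 2 / Real.log 2 / n := by
  -- A filter at 0⁺ gives the common lower bound without a minimum over a possibly empty index set.
  obtain ⟨ξ, hξ, hξx⟩ : ∃ ξ > 0, ∀ i, ξ ≤ x i := by
    have h1 := (Filter.eventually_all (l := nhdsWithin (0 : ℝ) (Set.Ioi 0))).2 fun i : Fin r =>
      eventually_nhdsWithin_of_eventually_nhds (Filter.Eventually.mono
        (Iio_mem_nhds (hx i).1) fun y (hy : y < x i) => hy.le)
    obtain ⟨ξ, h2, h3⟩ := (h1.and self_mem_nhdsWithin).exists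
    exact ⟨ξ, h3, h2⟩
  filter_upwards [eventually_exp_le hp hp_large hp_small hξ, eventually_ge_atTop 1]
    with n hn hn1 c hc
  have hn1' : (1 : ℝ) ≤ n := by exact_mod_cast hn1
  have hn0 : (0 : ℝ) < n := by linarith
  have hm : ∀ i, ξ * n - 1 ≤ #(block c i) := by
    intro i
    have h1 := (abs_lt.1 (hc i)).1
    have h2 := mul_le_mul_of_nonneg_right (hξx i) hn0.le
    linarith
  refine (meanLogAutos_le (hp n) (hq n) hm).trans ?_
  rw [Fintype.card_fin]
  set t := Real.exp (-(p n * (1 - p n) * ((ξ * n - 1 - 2) / 2))) with ht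
  have ht0 : 0 < t := Real.exp_pos _
  have h1 : n * (n * t) ≤ 1 / n := by
    calc n * (n * t) ≤ n * (n * (1 / (n : ℝ) ^ 3)) := by gcongr
      _ = 1 / n := by field_simp
  have h2 : 1 / (n : ℝ) ≤ 1 := by rw [div_le_one hn0]; exact hn1'
  -- Since n²t ≤ 1, the increment of exp is at most 2n²t ≤ 2/n.
  have h3 := Real.abs_exp_sub_one_le (x := n * (n * t))
    (by rw [abs_of_nonneg (by positivity)]; linarith)
  rw [abs_of_nonneg (a := (n : ℝ) * (n * t)) (by positivity)] at h3
  have h4 := (le_abs_self _).trans h3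
  rw [div_right_comm]
  refine div_le_div_of_nonneg_right (h4.trans ?_) (Real.log_pos one_lt_two).le
  calc 2 * (n * (n * t)) ≤ 2 * (1 / n) := by gcongr
    _ = 2 / n := by ring

theorem tendsto_choose_two : Tendsto (fun n : ℕ => (n.choose 2 : ℝ)) atTop atTop := by
  refine tendsto_atTop_mono' atTop ?_
    (tendsto_atTop_add_const_right atTop (-1) tendsto_natCast_atTop_atTop)
  filter_upwards [eventually_ge_atTop 2] with n hn
  have : (2 : ℝ) ≤ n := by exact_mod_cast hn
  rw [Nat.cast_choose_two]
  nlinarith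

/-- `log n!` is of smaller order than the number of pairs. -/
theorem eventually_mul_logb_factorial_le (r : ℕ) {ε : ℝ} (hε : 0 < ε) :
    ∀ᶠ n : ℕ in atTop, r * Real.logb 2 (n.factorial : ℝ) ≤ ε * (n.choose 2 : ℝ) := by
  have hl2 := Real.log_pos one_lt_two
  -- The 4 comes from n²/4 ≤ `n.choose 2` for n ≥ 2; r + 1 keeps the denominator nonzero when r = 0.
  have hδ : 0 < ε * Real.log 2 / (4 * (r + 1)) := by positivity
  filter_upwards [(Real.isLittleO_log_id_atTop.comp_tendsto
    tendsto_natCast_atTop_atTop).bound hδ, eventually_ge_atTop 2] with n h1 hn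
  have hn2 : (2 : ℝ) ≤ n := by exact_mod_cast hn
  have hn0 : (0 : ℝ) < n := by linarith
  have hlog : 0 ≤ Real.log n := Real.log_nonneg (by linarith)
  simp only [Function.comp, id, Real.norm_of_nonneg hlog, Real.norm_of_nonneg hn0.le] at h1
  have h2 : Real.log (n.factorial : ℝ) ≤ n * Real.log n := by
    rw [← Real.log_pow]
    refine Real.log_le_log (by positivity) ?_
    exact_mod_cast Nat.factorial_le_pow n
  have h3 : Real.logb 2 (n.factorial : ℝ) ≤ ε / (4 * (r + 1)) * n ^ 2 := by
    rw [Real.logb, div_le_iff₀ hl2]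
    refine h2.trans ((mul_le_mul_of_nonneg_left h1 hn0.le).trans (le_of_eq ?_))
    ring
  have h4 : (n : ℝ) ^ 2 / 4 ≤ (n.choose 2 : ℝ) := by
    rw [Nat.cast_choose_two]
    nlinarith
  calc r * Real.logb 2 (n.factorial : ℝ) ≤ (r + 1) * (ε / (4 * (r + 1)) * n ^ 2) := by
        refine mul_le_mul (by linarith) h3 ?_ (by positivity)
        exact Real.logb_nonneg one_lt_two (by exact_mod_cast Nat.factorial_pos n)
    _ = ε * (n ^ 2 / 4) := by field_simp
    _ ≤ _ := by gcongr

theorem logFactorials_mem_Icc {n r : ℕ} (c : Fin n → Fin r) :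
    logFactorials c ∈ Set.Icc 0 (r * Real.logb 2 (n.factorial : ℝ)) := by
  have h1 : ∀ k : ℕ, (1 : ℝ) ≤ k.factorial := fun k => by
    exact_mod_cast Nat.factorial_pos k
  constructor
  · exact Finset.sum_nonneg fun i _ => Real.logb_nonneg one_lt_two (h1 _)
  · have h2 := Finset.sum_le_card_nsmul (Finset.univ : Finset (Fin r))
      (fun i => Real.logb 2 ((#(block c i)).factorial : ℝ)) (Real.logb 2 (n.factorial : ℝ)) ?_
    · simpa [logFactorials] using h2
    · intro i _
      refine Real.logb_le_logb_of_le one_lt_two (by linarith [h1 #(block c i)]) ?_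
      exact_mod_cast Nat.factorial_le (by simpa using Finset.card_le_univ (block c i))

/-- For r ≤ n the argument is at least 2, where Γ is increasing and starts from Γ(2) = 1. This is
the same interval as for the sum of log-factorials, so the two values of Λ differ by at most its
length. -/
theorem mul_logb_Gamma_mem_Icc {n r : ℕ} (hr : 0 < r) (hn : r ≤ n) :
    r * Real.logb 2 (Real.Gamma ((n : ℝ) / r + 1)) ∈
      Set.Icc 0 (r * Real.logb 2 (n.factorial : ℝ)) := by
  have hr0 : (1 : ℝ) ≤ r := by exact_mod_cast hr
  have hrn : (r : ℝ) ≤ n := by exact_mod_cast hn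
  have h1 : 1 ≤ (n : ℝ) / r := by rwa [one_le_div (by linarith)]
  have h2 : (n : ℝ) / r ≤ n := div_le_self (by linarith) hr0
  have hmono := Real.Gamma_strictMonoOn_Ici.monotoneOn
  have h3 : 1 ≤ Real.Gamma ((n : ℝ) / r + 1) := by
    refine Real.Gamma_two.ge.trans ?_
    exact hmono (Set.mem_Ici.2 le_rfl) (Set.mem_Ici.2 (by linarith)) (by linarith)
  have h4 : Real.Gamma ((n : ℝ) / r + 1) ≤ n.factorial := by
    rw [← Real.Gamma_nat_eq_factorial]
    exact hmono (Set.mem_Ici.2 (by linarith)) (Set.mem_Ici.2 (by linarith)) (by linarith)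
  exact ⟨mul_nonneg (by linarith) (Real.logb_nonneg one_lt_two h3),
    mul_le_mul_of_nonneg_left (Real.logb_le_logb_of_le one_lt_two (by linarith) h4)
      (by linarith)⟩

end SBM

end

/-! ### The two statements assembled -/

theorem mainTheorem2 (r : ℕ) (x : Fin r → ℝ) (hx : ∀ i, x i ∈ Set.Ioo (0 : ℝ) 1)
    (hsum : ∑ i, x i = 1) (p q : ℕ → ℝ)
    (hp : ∀ n, p n ∈ Set.Icc (0 : ℝ) 1) (hq : ∀ n, q n ∈ Set.Icc (0 : ℝ) 1)
    (hp_large : (fun n : ℕ => Real.log n / n) =o[atTop] p)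
    (hq_large : (fun n : ℕ => Real.log n / n) =o[atTop] q)
    (hp_small : (fun n : ℕ => Real.log n / n) =o[atTop] (fun n => 1 - p n)) :
    (∃ α > (0 : ℝ), ∃ C : ℝ, ∃ N : ℕ, ∀ n ≥ N, ∀ c : Fin n → Fin r,
      (∀ i, |(#(SBM.block c i) : ℝ) - x i * n| < 1) →
      |SBM.structuralEntropy c (SBM.structProb c (p n) (q n)) -
          (SBM.z c * (SBM.h (p n) - SBM.h (q n)) + (n.choose 2 : ℝ) * SBM.h (q n)
            - SBM.logFactorials c)|
        ≤ C * (Real.logb 2 n / (n : ℝ) ^ α)) ∧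
    (∀ ε > (0 : ℝ), ∃ N : ℕ, ∀ n ≥ N, ∀ c : Fin n → Fin r,
      (∀ i, |(#(SBM.block c i) : ℝ) - x i * n| < 1) →
      SBM.prob c (p n) (q n) {S |
          |-(1 / (n.choose 2 : ℝ)) * Real.logb 2 (SBM.structProb c (p n) (q n) S)
            - SBM.z c / (n.choose 2 : ℝ) * (SBM.h (p n) - SBM.h (q n)) - SBM.h (q n)
            + SBM.logFactorials c / (n.choose 2 : ℝ)| < 3 * ε} > 1 - 4 * ε ∧
      SBM.prob c (p n) (q n) {S |
          |-(1 / (n.choose 2 : ℝ)) * Real.logb 2 (SBM.structProb c (p n) (q n) S)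
            - SBM.z c / (n.choose 2 : ℝ) * (SBM.h (p n) - SBM.h (q n)) - SBM.h (q n)
            + r * Real.logb 2 (Real.Gamma ((n : ℝ) / r + 1)) / (n.choose 2 : ℝ)| < 3 * ε}
        > 1 - 4 * ε) := by
  have hr : 0 < r := by
    rcases Nat.eq_zero_or_pos r with rfl | hr
    · simp at hsum
    · exact hr
  have hautos := SBM.eventually_meanLogAutos_le hx hp hq hp_large hp_small
  have hl2 := Real.log_pos one_lt_two
  constructor
  · obtain ⟨N, hN⟩ := eventually_atTop.1 hautos
    -- The error is at most 2/(n ln 2), so α = 1 works; n ≥ 2 ensures log₂ n ≥ 1.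
    refine ⟨1, one_pos, 2 / Real.log 2, max N 2, fun n hn c hc => ?_⟩
    have h1 := hN n (le_of_max_le_left hn) c hc
    have h2 : (2 : ℝ) ≤ n := by exact_mod_cast le_of_max_le_right hn
    have h3 : 1 ≤ Real.logb 2 n := by
      rw [Real.le_logb_iff_rpow_le one_lt_two (by linarith)]
      simpa using h2
    rw [SBM.structuralEntropy_structProb, SBM.sum_graphProb_mul_logProb, Fintype.card_fin,
      Real.rpow_one, abs_le]
    have h4 := SBM.meanLogAutos_nonneg c (hp n) (hq n)
    have h5 : 2 / Real.log 2 / n ≤ 2 / Real.log 2 * (Real.logb 2 n / n) := by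
      rw [div_eq_mul_one_div]
      gcongr
    constructor <;> linarith
  · intro ε hε
    -- These thresholds bring the Chebyshev and Markov terms below ε each, giving probability at
    -- least 1 - 2ε.
    have hlarge := SBM.tendsto_choose_two.eventually_ge_atTop
      (max 1 (max (8 / Real.log 2 ^ 2 / ε ^ 3) (2 / Real.log 2 / ε ^ 2)))
    obtain ⟨N, hN⟩ := eventually_atTop.1 (hautos.and (hlarge.and
      ((SBM.eventually_mul_logb_factorial_le r hε).and (eventually_ge_atTop r))))
    refine ⟨N, fun n hn c hc => ?_⟩
    obtain ⟨h1, h2, h3, h4⟩ := hN n hn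
    simp only [max_le_iff] at h2
    obtain ⟨hM1, hM2, hM3⟩ := h2
    set M : ℝ := (n.choose 2 : ℝ) with hM
    have hM0 : 0 < M := by linarith
    have hn1 : (1 : ℝ) ≤ n := by exact_mod_cast hr.trans_le h4
    have hmain : ∀ L : ℝ, |L - SBM.logFactorials c| ≤ ε * M →
        SBM.prob c (p n) (q n) {S |
          |-(1 / M) * Real.logb 2 (SBM.structProb c (p n) (q n) S)
            - SBM.z c / M * (SBM.h (p n) - SBM.h (q n)) - SBM.h (q n) + L / M| < 3 * ε}
          > 1 - 4 * ε := by
      intro L hL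
      have h5 := SBM.one_sub_le_prob (hp n) (hq n) hε hM0 (by rw [Fintype.card_fin]) hL (h1 c hc)
      have h6 : M * (8 / Real.log 2 ^ 2) / (ε * M) ^ 2 ≤ ε := by
        rw [div_le_iff₀ (by positivity)] at hM2 ⊢
        calc M * (8 / Real.log 2 ^ 2) ≤ M * (M * ε ^ 3) := by gcongr
          _ = ε * (ε * M) ^ 2 := by ring
      have h7 : 2 / Real.log 2 / n / (ε * M) ≤ ε := by
        have h8 : 2 / Real.log 2 / n ≤ 2 / Real.log 2 := div_le_self (by positivity) hn1
        rw [div_le_iff₀ (by positivity)] at hM3 ⊢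
        nlinarith
      refine lt_of_lt_of_le ?_ h5
      linarith
    refine ⟨hmain _ (by simpa using (by positivity : 0 ≤ ε * M)), hmain _ ?_⟩
    have h5 := SBM.logFactorials_mem_Icc c
    have h6 := SBM.mul_logb_Gamma_mem_Icc hr h4
    rw [abs_le]
    constructor <;> linarith [h5.1, h5.2, h6.1, h6.2]
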